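/- Let $C$ be a nonzero finite-dimensional Hilbert space. An $n$-outcome measurement on $C$ is a tuple $N=(N_1,\dots,N_n)$ of positive semidefinite operators on $C$ with $\sum_x N_x=I_C$. Let $\mathbb M=\{M^1,\dots,M^k\}$ be measurements on $C$ with $l$ outcomes, let $\mathbb N=\{N^1,\dots,N^m\}$ be measurements on $C$ with $n$ outcomes ($k,m\ge 1$), and let $\epsilon\ge 0$. $\mathbb M$ simulates $\mathbb N'=\{N'^1,\dots,N'^m\}$ if every $N'^y$ is a convex combination of postprocessings of the $M^i$: there are probabilities $q(i|y)$ and conditional probabilities $p_{i,y}(x|j)$ with $N'^y_x=\sum_i q(i|y)\sum_j p_{i,y}(x|j)M^i_j$ for all $x,y$. To $\mathbb N$ we associate the channel $\Phi_{\mathbb N}:\mathcal B(\mathbb C^m\otimes C)\to\mathcal B(\mathbb C^n)$, $$\Phi_{\mathbb N}(X)=\sum_{x,y}\mathrm{Tr}\big[X(|y\rangle\langle y|\otimes N^y_x)\big]\,|x\rangle\langle x| .$$ $\mathbb N$ is $\epsilon$-simulable by $\mathbb M$ if $\mathbb M$ simulates some family $\mathbb N'$ of $m$ measurements on $C$ with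 $n$ outcomes such that $\|\Phi_{\mathbb N}-\Phi_{\mathbb N'}\|_\diamond\le\epsilon$, where $\|\Phi\|_\diamond=\max_\rho\|(\Phi\otimes id)(\rho)\|_1$ over density operators $\rho$ on two copies of the input space of $\Phi$. For an ensemble $\mathcal E=\{\lambda_x,\rho_x\}_{x=1}^r$ of states on $C$ with prior probabilities $\lambda_x$, let $$P_{\mathrm{succ}}(\mathcal E)=\max_F\sum_x\lambda_x\mathrm{Tr}[\rho_xF_x],$$ where the maximum is over all $r$-outcome measurements $F$ on $C$, and for an $l$-outcome measurement $M$ on $C$ let $$P^Q_{\mathrm{succ}}(\mathcal E,M)=\max_p\sum_{x,j}\lambda_x\,p(x|j)\,\mathrm{Tr}[\rho_xM_j],$$ where the maximum is over all conditional probabilities $p(x|j)$, $x\le r$, $j\le l$. Then $\mathbb N$ is $\epsilon$-simulable by $\mathbb M$ if and only if, for every $r$ and every ensemble $\mathcal E$ of $r$ states on $C$, $$\max_{1\le y\le m}P^Q_{\mathrm{succ}}(\mathcal E,N^y)\le\max_{1\le i\le k}P^Q_{\mathrm{succ}}(\mathcal E,M^i)+\frac{\epsilon}{2}P_{\mathrm{succ}}(\mathcal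 E).$$ -/

import Mathlib

noncomputable section

namespace MeasSim

open scoped ComplexOrder MatrixOrder

/-- `ρ` is a state (density matrix) on the system with orthonormal basis indexed by `A`. -/
def IsState {A : Type*} [Fintype A] (ρ : Matrix A A ℂ) : Prop :=
  ρ.PosSemidef ∧ ρ.trace = 1

/-- A measurement (POVM) with `n` outcomes on the system with basis `C`. -/
structure Measurement (C : Type*) [Fintype C] [DecidableEq C] (n : ℕ) where
  op : Fin n → Matrix C C ℂ
  posSemidef : ∀ x, (op x).PosSemidef
  sum_eq_one : ∑ x, op x = 1

/-- An ensemble of `r` states on the system with basis `C`, with prior probabilities. -/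
structure Ensemble (C : Type*) [Fintype C] (r : ℕ) where
  prob : Fin r → ℝ
  prob_mem : prob ∈ stdSimplex ℝ (Fin r)
  state : Fin r → Matrix C C ℂ
  isState : ∀ x, IsState (state x)

/-- Conditional probabilities `p j x = p(x|j)`, for `x : Fin n` given `j : Fin l`. -/
def IsCondProb {l n : ℕ} (p : Fin l → Fin n → ℝ) : Prop :=
  ∀ j, p j ∈ stdSimplex ℝ (Fin n)

section Guessing

variable {C : Type*} [Fintype C] [DecidableEq C] {r : ℕ}

/-- Average probability of a correct guess in the ensemble `E` using the measurement `F`. -/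
def succProbWith (E : Ensemble C r) (F : Measurement C r) : ℝ :=
  ∑ x, E.prob x * (E.state x * F.op x).trace.re

/-- Optimal success probability of the ensemble `E`, over all measurements. -/
def succProb (E : Ensemble C r) : ℝ :=
  sSup (Set.range (succProbWith E))

/-- Average probability of a correct guess when the fixed measurement `M` is performed and `x` is
guessed with probability `p j x` upon the outcome `j`. -/
def succProbPost {l : ℕ} (E : Ensemble C r) (M : Measurement C l) (p : Fin l → Fin r → ℝ) : ℝ :=
  ∑ x, ∑ j, E.prob x * p j x * (E.state x * M.op j).trace.re

/-- Optimal success probability when only the fixed measurement `M` can be performed. -/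
def succProbQ {l : ℕ} (E : Ensemble C r) (M : Measurement C l) : ℝ :=
  sSup {t | ∃ p : Fin l → Fin r → ℝ, IsCondProb p ∧ t = succProbPost E M p}

end Guessing

section DiamondNorm

/-- The trace norm `‖X‖₁ = Tr |X|`, where `|X| = (X* X) ^ (1/2)`. -/
def traceNorm {A : Type*} [Fintype A] [DecidableEq A] (X : Matrix A A ℂ) : ℝ :=
  (CFC.abs X).trace.re

/-- The map `Φ ⊗ id_R`, acting on block matrices. -/
def tensorId {A B : Type*} (R : Type*)
    (Φ : Matrix A A ℂ →ₗ[ℂ] Matrix B B ℂ) (X : Matrix (A × R) (A × R) ℂ) :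
    Matrix (B × R) (B × R) ℂ :=
  Matrix.of fun b b' => Φ (Matrix.of fun a a' => X (a, b.2) (a', b'.2)) b.1 b'.1

/-- The diamond norm: the largest `‖(Φ ⊗ id)(ρ)‖₁` over states `ρ` on two copies of the input. -/
def diamondNorm {A B : Type*} [Fintype A] [DecidableEq A] [Fintype B] [DecidableEq B]
    (Φ : Matrix A A ℂ →ₗ[ℂ] Matrix B B ℂ) : ℝ :=
  sSup {t | ∃ ρ : Matrix (A × A) (A × A) ℂ, IsState ρ ∧ t = traceNorm (tensorId A Φ ρ)}

end DiamondNorm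

section Simulation

variable {C : Type*} [Fintype C] [DecidableEq C] {k l m n : ℕ}

/-- The channel representing a family `N` of `m` measurements with `n` outcomes: the classical
input `y` selects the measurement `N y`, which is applied to the quantum input, and the outcome is
the classical output. Hence `|y⟩⟨y'| ⊗ σ ↦ δ_{y,y'} ∑ x, Tr[σ N y x] |x⟩⟨x|`, with Choi matrix
`∑ x y, |x⟩⟨x| ⊗ |y⟩⟨y| ⊗ (N y x)ᵀ`. -/
def channel (N : Fin m → Measurement C n) :
    Matrix (Fin m × C) (Fin m × C) ℂ →ₗ[ℂ] Matrix (Fin n) (Fin n) ℂ where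
  toFun X := Matrix.diagonal fun x =>
    ∑ y, (Matrix.of (fun c c' => X (y, c) (y, c')) * (N y).op x).trace
  map_add' X Y := by
    rw [Matrix.diagonal_add]
    congr 1
    funext x
    rw [← Finset.sum_add_distrib]
    refine Finset.sum_congr rfl fun y _ => ?_
    rw [← Matrix.trace_add, ← Matrix.add_mul]
    rfl
  map_smul' a X := by
    rw [RingHom.id_apply, ← Matrix.diagonal_smul]
    congr 1
    funext x
    rw [Pi.smul_apply, Finset.smul_sum]
    refine Finset.sum_congr rfl fun y _ => ?_
    rw [← Matrix.trace_smul, ← Matrix.smul_mul]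
    rfl

/-- The family `M` simulates the family `N`: every member of `N` is a convex combination of
postprocessings of members of `M`. -/
def Simulates (M : Fin k → Measurement C l) (N : Fin m → Measurement C n) : Prop :=
  ∀ y, ∃ q ∈ stdSimplex ℝ (Fin k), ∃ p : Fin k → Fin l → Fin n → ℝ, (∀ i, IsCondProb (p i)) ∧
    ∀ x, (N y).op x = ∑ i, q i • ∑ j, p i j x • (M i).op j

/-- `N` is `ε`-simulable by `M`: some family simulated by `M` is `ε`-close to `N` in diamond
norm. -/
def IsSimulable (ε : ℝ) (N : Fin m → Measurement C n) (M : Fin k → Measurement C l) : Prop :=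
  ∃ N' : Fin m → Measurement C n, Simulates M N' ∧ diamondNorm (channel N - channel N') ≤ ε

end Simulation

end MeasSim

end

/-! Both conditions are statements about families `0 ≤ A_x ≤ σ` on `C`. The difference of two
measurement channels has traceless output `T`, so its trace norm is twice the maximum of `Tr(T P)`
over `0 ≤ P ≤ 1`. Moving `P` to the reference system gives `∑ Tr[W_{y,x}(N^y_x - N'^y_x)]` with `0 ≤
W_{y,x} ≤ σ_y` and `∑ Tr σ_y = 1` (`exists_traceNorm_tensorId_channel_sub`). Conversely, purifying
`σ` realizes every such family (`two_mul_sum_trace_le`). So the distance is at most `ε` iff `∑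
Tr[A_x(N^y_x - N'^y_x)] ≤ (ε/2) Tr σ` for all `y` and all `0 ≤ A_x ≤ σ`. By duality, `P_succ` is the
least `Tr σ` with `λ_x ρ_x ≤ σ` for all `x` (`exists_isState_weighted_le`,
`succProb_le_of_weighted_le`).

Necessity: averaging an ensemble over an optimal guessing rule for `N^y` gives such a family with
`Tr σ = P_succ`, and a simulated measurement guesses no better than the best `M^i`.

Sufficiency: a family `A`, normalized, is an ensemble, and the hypothesis yields a simulated
measurement good for that `A`. The simulated measurements have compact convex parameters, so a
minimax argument gives one good for all `A` (`exists_simulated_le`). -/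

namespace MeasSim

open scoped ComplexOrder MatrixOrder

/-! ### Minimax with one compact side -/

section Minimax

variable {E F : Type*} [AddCommGroup E] [Module ℝ E] [TopologicalSpace E]
  [IsTopologicalAddGroup E] [ContinuousSMul ℝ E]
  [AddCommGroup F] [Module ℝ F] [TopologicalSpace F]
  [IsTopologicalAddGroup F] [ContinuousSMul ℝ F]

/-- A consequence of the minimax theorem in which only one of the two strategy sets is compact. -/
theorem exists_forall_le_of_forall_exists_le {X : Set E} {Y : Set F} {f : E → F → ℝ}
    (hX : IsCompact X) (hXc : Convex ℝ X) (hXn : X.Nonempty) (hY : Convex ℝ Y)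
    (hf₁ : ∀ y, Continuous fun x => f x y) (hf₂ : ∀ x, Continuous (f x))
    (ha₁ : ∀ x x' y (a b : ℝ), a + b = 1 → f (a • x + b • x') y = a * f x y + b * f x' y)
    (ha₂ : ∀ x y y' (a b : ℝ), a + b = 1 → f x (a • y + b • y') = a * f x y + b * f x y')
    (h : ∀ y ∈ Y, ∃ x ∈ X, f x y ≤ 0) : ∃ x ∈ X, ∀ y ∈ Y, f x y ≤ 0 := by
  -- By compactness of `X`, finitely many `y` suffice. Their convex hull is compact, so Sion's
  -- theorem applies to it.
  have key : (X ∩ ⋂ y : Y, {x | f x y ≤ 0}).Nonempty := by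
    refine hX.inter_iInter_nonempty _
      (fun y => isClosed_le (hf₁ y) continuous_const) fun t => ?_
    by_cases ht : t.Nonempty
    · have hsub : convexHull ℝ (Subtype.val '' (t : Set Y)) ⊆ Y :=
        convexHull_min (by rintro _ ⟨y, -, rfl⟩; exact y.2) hY
      obtain ⟨a, haX, b, hb, hab⟩ := Sion.exists_isSaddlePointOn (f := f) hXn hXc hX
        (fun y _ => (hf₁ y).continuousOn.lowerSemicontinuousOn)
        (fun y _ => ConvexOn.quasiconvexOn
          ⟨hXc, fun x _ x' _ a b _ _ hab => (ha₁ x x' y a b hab).le⟩)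
        (convex_convexHull ℝ (Subtype.val '' (t : Set Y)))
        (by simpa using ht)
        (Set.Finite.isCompact_convexHull (𝕜 := ℝ) (t.finite_toSet.image _))
        (fun x _ => (hf₂ x).continuousOn.upperSemicontinuousOn)
        (fun x _ => ConcaveOn.quasiconcaveOn
          ⟨convex_convexHull ℝ _, fun y _ y' _ a b _ _ hab => (ha₂ x y y' a b hab).ge⟩)
      -- At a saddle point `(a, b)`, `f a y ≤ f x b` for all `x` and `y`; the reply `x` to `b` makes
      -- this nonpositive.
      obtain ⟨x, hx, hxb⟩ := h b (hsub hb)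
      refine ⟨a, haX, ?_⟩
      simp only [Set.mem_iInter, Set.mem_ofPred_eq]
      exact fun y hy => (hab x hx y (subset_convexHull ℝ _ ⟨y, hy, rfl⟩)).trans hxb
    · rw [Finset.not_nonempty_iff_eq_empty] at ht
      subst ht
      simpa using hXn
  obtain ⟨x, hx, hx'⟩ := key
  simp only [Set.mem_iInter, Set.mem_ofPred_eq] at hx'
  exact ⟨x, hx, fun y hy => hx' ⟨y, hy⟩⟩

end Minimax

/-! ### Positive operators and compactness of the state space -/

section PosSemidef

open Matrix

theorem convex_posSemidef {A : Type*} : Convex ℝ {X : Matrix A A ℂ | X.PosSemidef} :=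
  fun _ hX _ hY _ _ ha hb _ => (hX.smul ha).add (hY.smul hb)

variable {A : Type*} [Fintype A]

theorem trace_mul_re_nonneg {X Y : Matrix A A ℂ} (hX : X.PosSemidef) (hY : Y.PosSemidef) :
    0 ≤ (X * Y).trace.re := by
  classical
  obtain ⟨B, rfl⟩ := CStarAlgebra.nonneg_iff_eq_star_mul_self.mp hY.nonneg
  rw [← Matrix.mul_assoc, Matrix.trace_mul_comm, ← Matrix.mul_assoc]
  exact (Complex.nonneg_iff.mp (hX.mul_mul_conjTranspose_same B).trace_nonneg).1

theorem trace_mul_re_mono {X Y Z : Matrix A A ℂ} (hX : X.PosSemidef) (h : Y ≤ Z) :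
    (X * Y).trace.re ≤ (X * Z).trace.re := by
  have := trace_mul_re_nonneg hX h
  rw [Matrix.mul_sub, Matrix.trace_sub, Complex.sub_re] at this
  linarith

theorem trace_re_mul_comm (X Y : Matrix A A ℂ) : (X * Y).trace.re = (Y * X).trace.re := by
  rw [Matrix.trace_mul_comm]

theorem isClosed_posSemidef : IsClosed {X : Matrix A A ℂ | X.PosSemidef} := by
  classical
  simp only [posSemidef_iff_dotProduct_mulVec, Set.ofPred_and, Set.ofPred_forall]
  refine IsClosed.inter (isClosed_eq (by fun_prop) continuous_id) (isClosed_iInter fun v => ?_)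
  exact isClosed_le continuous_const (by fun_prop)

/-- Nonnegative `2 × 2` minors give `|X i j|² ≤ X i i * X j j`. This bounds the set of states. -/
theorem norm_apply_le_trace {X : Matrix A A ℂ} (hX : X.PosSemidef) (i j : A) :
    ‖X i j‖ ≤ X.trace.re := by
  have hd : ∀ i, 0 ≤ (X i i).re ∧ (X i i).im = 0 := fun i => by
    have := Complex.nonneg_iff.mp (hX.diag_nonneg (i := i))
    exact ⟨this.1, this.2.symm⟩
  have hle : ∀ i, (X i i).re ≤ X.trace.re := fun i => by
    rw [Matrix.trace, Complex.re_sum]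
    exact Finset.single_le_sum (f := fun i => (X i i).re) (fun i _ => (hd i).1)
      (Finset.mem_univ i)
  have hdet := (hX.submatrix ![i, j]).det_nonneg
  rw [Matrix.det_fin_two] at hdet
  have h2 := (Complex.nonneg_iff.mp hdet).1
  have hji : X j i = star (X i j) := (hX.1.apply j i).symm
  have hn : ‖X i j‖ ^ 2 = (X i j).re * (X i j).re + (X i j).im * (X i j).im := by
    rw [← Complex.normSq_eq_norm_sq, Complex.normSq_apply]
  simp [hji, (hd i).2, (hd j).2] at h2
  refine abs_le_of_sq_le_sq' ?_ ((hd i).1.trans (hle i)) |>.2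
  nlinarith [hle i, hle j, (hd i).1, (hd j).1]

theorem isCompact_isState : IsCompact {X : Matrix A A ℂ | IsState X} := by
  have hK : IsCompact (Set.pi Set.univ fun _ : A => Set.pi Set.univ fun _ : A =>
      Metric.closedBall (0 : ℂ) 1 : Set (Matrix A A ℂ)) :=
    isCompact_univ_pi fun _ => isCompact_univ_pi fun _ => isCompact_closedBall (0 : ℂ) 1
  refine hK.of_isClosed_subset ?_ ?_
  · exact isClosed_posSemidef.inter (isClosed_eq (by fun_prop) continuous_const)
  · intro X hX i _ j _
    simpa [hX.2] using norm_apply_le_trace hX.1 i j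

theorem convex_isState : Convex ℝ {X : Matrix A A ℂ | IsState X} := by
  refine fun X hX Y hY a b ha hb hab => ⟨convex_posSemidef hX.1 hY.1 ha hb hab, ?_⟩
  rw [Matrix.trace_add, Matrix.trace_smul, Matrix.trace_smul, hX.2, hY.2, ← add_smul, hab,
    one_smul]

theorem isState_smul_one [DecidableEq A] [Nonempty A] :
    IsState (((Fintype.card A : ℝ)⁻¹) • (1 : Matrix A A ℂ)) := by
  refine ⟨Matrix.PosSemidef.one.smul (by positivity), ?_⟩
  rw [Matrix.trace_smul, Matrix.trace_one]
  have : (Fintype.card A : ℂ) ≠ 0 := by simp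
  simp [this]

end PosSemidef

/-! ### Variational formula for the trace norm -/

section TraceNorm

open Matrix

variable {A : Type*} [Fintype A] [DecidableEq A]

theorem traceNorm_add_trace {T : Matrix A A ℂ} (hT : T.IsHermitian) :
    traceNorm T + T.trace.re = 2 * (T⁺).trace.re := by
  have := congrArg (fun X => X.trace.re) (CFC.abs_add_self T hT.isSelfAdjoint)
  simpa [traceNorm, two_smul, two_mul] using this

/-- `T ≤ T⁺` and `P ≤ 1` give `Tr(T P) ≤ Tr(T⁺ P) ≤ Tr T⁺`. -/
theorem two_mul_trace_mul_le_traceNorm {T P : Matrix A A ℂ} (hT : T.IsHermitian)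
    (hP : P.PosSemidef) (hP1 : P ≤ 1) :
    2 * (T * P).trace.re ≤ traceNorm T + T.trace.re := by
  rw [traceNorm_add_trace hT]
  have h1 : (P * T).trace.re ≤ (P * T⁺).trace.re :=
    trace_mul_re_mono hP (CFC.le_posPart hT.isSelfAdjoint)
  have h2 := trace_mul_re_mono (CFC.posPart_nonneg T).posSemidef hP1
  rw [trace_re_mul_comm, Matrix.mul_one] at h2
  rw [trace_re_mul_comm]
  linarith

theorem exists_two_mul_trace_mul_eq_traceNorm {T : Matrix A A ℂ} (hT : T.IsHermitian) :
    ∃ P : Matrix A A ℂ, P.PosSemidef ∧ P ≤ 1 ∧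
      2 * (T * P).trace.re = traceNorm T + T.trace.re := by
  have hc : ∀ f : ℝ → ℝ, ContinuousOn f (spectrum ℝ T) := fun f =>
    (Matrix.finite_real_spectrum (A := T)).continuousOn f
  -- The spectral projection of `T` onto `(0, ∞)`, for which `T P = T⁺`.
  refine ⟨cfc (fun x : ℝ => if 0 < x then 1 else 0) T, ?_, ?_, ?_⟩
  · exact (cfc_nonneg fun x _ => by split_ifs <;> simp).posSemidef
  · exact cfc_le_one _ _ fun x _ => by split_ifs <;> simp
  · rw [traceNorm_add_trace hT]
    congr 3
    rw [CFC.posPart_def, cfcₙ_eq_cfc]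
    conv_lhs => enter [1]; rw [← cfc_id' ℝ T hT.isSelfAdjoint]
    rw [← cfc_mul _ _ T (hc _) (hc _)]
    refine cfc_congr fun x _ => ?_
    by_cases hx : 0 < x
    · simp [hx, hx.le]
    · simp [hx, not_lt.mp hx]

end TraceNorm

/-! ### Duality for the optimal success probability -/

section Duality

open Matrix

/-- Normalized rank-one states recover the quadratic form of `H`. -/
theorem posSemidef_of_forall_isState {A : Type*} [Fintype A] {H : Matrix A A ℂ}
    (hH : H.IsHermitian) (h : ∀ ρ, IsState ρ → 0 ≤ (ρ * H).trace.re) : H.PosSemidef := by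
  refine PosSemidef.of_dotProduct_mulVec_nonneg hH fun v => ?_
  have him : (star v ⬝ᵥ H *ᵥ v).im = 0 := hH.im_star_dotProduct_mulVec_self v
  refine Complex.nonneg_iff.mpr ⟨?_, him.symm⟩
  by_cases hv : v = 0
  · simp [hv]
  have hpos : 0 < v ⬝ᵥ star v := by
    rw [dotProduct_comm]
    exact dotProduct_star_self_pos_iff.mpr hv
  obtain ⟨s, hs, hsv⟩ : ∃ s : ℝ, 0 < s ∧ (s : ℂ) = v ⬝ᵥ star v := by
    refine ⟨(v ⬝ᵥ star v).re, (Complex.pos_iff.mp hpos).1, ?_⟩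
    exact Complex.ext rfl (Complex.pos_iff.mp hpos).2
  have hst : IsState (s⁻¹ • vecMulVec v (star v)) := by
    refine ⟨(posSemidef_vecMulVec_self_star v).smul (by positivity), ?_⟩
    rw [trace_smul, trace_vecMulVec, ← hsv, Complex.real_smul, Complex.ofReal_inv,
      inv_mul_cancel₀ (by exact_mod_cast hs.ne')]
  have h1 := h _ hst
  rw [Matrix.smul_mul, trace_smul, vecMulVec_mul, trace_vecMulVec, dotProduct_comm,
    ← dotProduct_mulVec, Complex.smul_re, smul_eq_mul] at h1
  exact nonneg_of_mul_nonneg_right h1 (by positivity)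

variable {C : Type*} [Fintype C] {r l n : ℕ}

/-- The unnormalized states `λ_x ρ_x` of an ensemble. -/
noncomputable def Ensemble.weighted (E : Ensemble C r) (x : Fin r) : Matrix C C ℂ :=
  E.prob x • E.state x

theorem Ensemble.weighted_posSemidef (E : Ensemble C r) (x : Fin r) :
    (E.weighted x).PosSemidef :=
  (E.isState x).1.smul (E.prob_mem.1 x)

theorem Ensemble.trace_weighted (E : Ensemble C r) (x : Fin r) :
    (E.weighted x).trace.re = E.prob x := by
  simp [Ensemble.weighted, trace_smul, (E.isState x).2]

variable [DecidableEq C]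

theorem Measurement.op_le_one (F : Measurement C r) (x : Fin r) : F.op x ≤ 1 := by
  rw [← F.sum_eq_one]
  exact Finset.single_le_sum (f := F.op) (fun i _ => (F.posSemidef i).nonneg) (Finset.mem_univ x)

theorem Ensemble.trace_weighted_mul (E : Ensemble C r) (x : Fin r) (X : Matrix C C ℂ) :
    (E.weighted x * X).trace.re = E.prob x * (E.state x * X).trace.re := by
  simp [Ensemble.weighted, trace_smul]

theorem succProbWith_eq (E : Ensemble C r) (F : Measurement C r) :
    succProbWith E F = ∑ x, (E.weighted x * F.op x).trace.re := by
  simp [succProbWith, Ensemble.trace_weighted_mul]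

theorem bddAbove_succProbWith (E : Ensemble C r) : BddAbove (Set.range (succProbWith E)) := by
  refine ⟨1, ?_⟩
  rintro _ ⟨F, rfl⟩
  rw [succProbWith_eq, ← E.prob_mem.2]
  refine Finset.sum_le_sum fun x _ => ?_
  have := trace_mul_re_mono (E.weighted_posSemidef x) (F.op_le_one x)
  rwa [Matrix.mul_one, E.trace_weighted] at this

theorem succProbWith_le_succProb (E : Ensemble C r) (F : Measurement C r) :
    succProbWith E F ≤ succProb E :=
  le_csSup (bddAbove_succProbWith E) ⟨F, rfl⟩

/-- Every family of positive operators whose sum is at most `1` can be completed to a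
measurement by enlarging one of its members. -/
theorem exists_measurement_ge (x₀ : Fin r) {G : Fin r → Matrix C C ℂ}
    (hG : ∀ x, (G x).PosSemidef) (hsum : ∑ x, G x ≤ 1) :
    ∃ F : Measurement C r, ∀ x, G x ≤ F.op x := by
  have hR : ∀ x, 0 ≤ (if x = x₀ then 1 - ∑ x, G x else 0) := fun x => by
    split_ifs
    · exact sub_nonneg.mpr hsum
    · exact le_rfl
  refine ⟨⟨fun x => G x + if x = x₀ then 1 - ∑ x, G x else 0,
    fun x => (add_nonneg (hG x).nonneg (hR x)).posSemidef, ?_⟩, fun x => ?_⟩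
  · rw [Finset.sum_add_distrib]
    simp
  · exact le_add_of_nonneg_right (hR x)

/-- A state maximizing `Tr(σ S)` exists by compactness; the maximum is the top eigenvalue of `S`. -/
theorem exists_trace_eq_and_le [Nonempty C] {S : Matrix C C ℂ} (hS : S.IsHermitian) :
    ∃ σ, IsState σ ∧ S ≤ (σ * S).trace.re • (1 : Matrix C C ℂ) := by
  obtain ⟨σ, hσ, hmax⟩ := isCompact_isState.exists_isMaxOn ⟨_, isState_smul_one (A := C)⟩
    (f := fun σ => (σ * S).trace.re) (by fun_prop)
  refine ⟨σ, hσ, posSemidef_of_forall_isState (IsHermitian.sub ?_ hS) fun ρ hρ => ?_⟩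
  · simp [IsHermitian]
  · have := hmax hρ
    simp only [Set.mem_ofPred_eq] at this
    simpa [Matrix.mul_sub, hρ.2] using this

/-- The dual program for the optimal success probability. -/
theorem exists_isState_weighted_le [Nonempty C] (E : Ensemble C r) :
    ∃ σ, IsState σ ∧ ∀ x, E.weighted x ≤ succProb E • σ := by
  have hr : ∃ x₀ : Fin r, True := by
    by_contra! h
    have := E.prob_mem.2
    have hs : ∑ x, E.prob x = 0 := Finset.sum_eq_zero fun x _ => (h x).elim
    linarith
  obtain ⟨x₀, -⟩ := hr
  -- Relaxing measurements to arbitrary positive families `G` makes the objective linear on a cone.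
  -- Testing with `G` supported at a single `x` then recovers the operator inequality for that `x`.
  suffices h : ∃ σ ∈ {σ : Matrix C C ℂ | IsState σ}, ∀ G ∈ {G : Fin r → Matrix C C ℂ |
      ∀ x, (G x).PosSemidef},
      ∑ x, ((E.weighted x * G x).trace.re - succProb E * (σ * G x).trace.re) ≤ 0 by
    obtain ⟨σ, hσ, h⟩ := h
    refine ⟨σ, hσ, fun x => posSemidef_of_forall_isState
      ((hσ.1.1.smul (by simp [IsSelfAdjoint])).sub (E.weighted_posSemidef x).1) fun ρ hρ => ?_⟩
    have := h (Pi.single x ρ) fun x' => by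
      by_cases hx : x' = x
      · subst hx; simpa using hρ.1
      · simpa [hx] using PosSemidef.zero
    rw [Finset.sum_eq_single x (fun x' _ hx => by simp [hx]) (by simp)] at this
    simp only [Pi.single_eq_same] at this
    rw [trace_re_mul_comm, Matrix.sub_mul, trace_sub, Complex.sub_re, Matrix.smul_mul, trace_smul,
      Complex.smul_re, smul_eq_mul]
    linarith
  refine exists_forall_le_of_forall_exists_le (X := {σ : Matrix C C ℂ | IsState σ})
    (Y := {G : Fin r → Matrix C C ℂ | ∀ x, (G x).PosSemidef})
    (f := fun σ G => ∑ x, ((E.weighted x * G x).trace.re - succProb E * (σ * G x).trace.re))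
    isCompact_isState convex_isState ⟨_, isState_smul_one⟩
    (fun G hG G' hG' a b ha hb hab x => convex_posSemidef (hG x) (hG' x) ha hb hab)
    (fun G => by fun_prop) (fun σ => by fun_prop) ?_ ?_ ?_
  · intro σ σ' G a b hab
    have hx : ∀ x, ((a • σ + b • σ') * G x).trace.re
        = a * (σ * G x).trace.re + b * (σ' * G x).trace.re := fun x => by
      simp [Matrix.add_mul]
    simp only [hx, Finset.mul_sum, ← Finset.sum_add_distrib]
    refine Finset.sum_congr rfl fun x _ => ?_
    linear_combination -(E.weighted x * G x).trace.re * hab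
  · intro σ G G' a b hab
    simp only [Finset.mul_sum, ← Finset.sum_add_distrib]
    refine Finset.sum_congr rfl fun x _ => ?_
    simp [Matrix.mul_add]
    ring
  · intro G hG
    -- The reply `σ` attains the top eigenvalue `s` of `∑ G x`. If `s > 0`, then `s⁻¹ • G` can be
    -- completed to a measurement; if `s = 0`, then every `G x ≤ 0`.
    have hS := posSemidef_sum Finset.univ fun x _ => hG x
    obtain ⟨σ, hσ, hle⟩ := exists_trace_eq_and_le hS.1
    refine ⟨σ, hσ, ?_⟩
    have hs0 : 0 ≤ (σ * ∑ x, G x).trace.re := trace_mul_re_nonneg hσ.1 hS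
    have hsplit : ∑ x, ((E.weighted x * G x).trace.re - succProb E * (σ * G x).trace.re)
        = ∑ x, (E.weighted x * G x).trace.re - succProb E * (σ * ∑ x, G x).trace.re := by
      rw [Finset.sum_sub_distrib, ← Finset.mul_sum, Matrix.mul_sum, trace_sum, Complex.re_sum]
    rw [hsplit, sub_nonpos]
    generalize (σ * ∑ x, G x).trace.re = s at hle hs0
    rcases hs0.eq_or_lt with rfl | hs
    · rw [mul_zero]
      refine Finset.sum_nonpos fun x _ => ?_
      have hx : G x ≤ 0 := (Finset.single_le_sum (f := G) (fun i _ => (hG i).nonneg)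
        (Finset.mem_univ x)).trans (by simpa using hle)
      simpa using trace_mul_re_mono (E.weighted_posSemidef x) hx
    · obtain ⟨F, hF⟩ := exists_measurement_ge x₀ (G := fun x => s⁻¹ • G x)
        (fun x => (hG x).smul (by positivity)) (by
          rw [← Finset.smul_sum]
          have := smul_le_smul_of_nonneg_left hle (inv_nonneg.mpr hs.le)
          rwa [smul_smul, inv_mul_cancel₀ hs.ne', one_smul] at this)
      have h1 := succProbWith_le_succProb E F
      rw [succProbWith_eq] at h1
      have h2 : s⁻¹ * ∑ x, (E.weighted x * G x).trace.re
          ≤ ∑ x, (E.weighted x * F.op x).trace.re := by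
        rw [Finset.mul_sum]
        refine Finset.sum_le_sum fun x _ => ?_
        simpa using trace_mul_re_mono (E.weighted_posSemidef x) (hF x)
      have h3 := h2.trans h1
      rwa [inv_mul_le_iff₀ hs, mul_comm] at h3

end Duality

/-! ### Partial trace against an operator on the reference -/

section PartialTrace

open Matrix

variable {A R : Type*} [Fintype R]

/-- The partial trace `Tr_R [X (1 ⊗ Q)]`. -/
def partialTr (X : Matrix (A × R) (A × R) ℂ) (Q : Matrix R R ℂ) : Matrix A A ℂ :=
  Matrix.of fun a a' => ∑ r, ∑ r', X (a, r) (a', r') * Q r' r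

theorem partialTr_eq_sum (X : Matrix (A × R) (A × R) ℂ) (Q : Matrix R R ℂ) :
    partialTr X Q = ∑ r, ∑ r', Q r' r • Matrix.of fun a a' => X (a, r) (a', r') := by
  ext a a'
  simp [partialTr, Matrix.sum_apply, mul_comm]

theorem partialTr_sub (X : Matrix (A × R) (A × R) ℂ) (Q Q' : Matrix R R ℂ) :
    partialTr X (Q - Q') = partialTr X Q - partialTr X Q' := by
  ext a a'
  simp [partialTr, mul_sub]

variable [Fintype A]

theorem trace_partialTr_mul (X : Matrix (A × R) (A × R) ℂ) (Q : Matrix R R ℂ)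
    (D : Matrix A A ℂ) :
    (partialTr X Q * D).trace
      = ∑ r, ∑ r', (Matrix.of (fun a a' => X (a, r) (a', r')) * D).trace * Q r' r := by
  simp only [partialTr_eq_sum, Matrix.sum_mul, trace_sum, Matrix.smul_mul, trace_smul, smul_eq_mul,
    mul_comm]

theorem trace_partialTr_one [DecidableEq R] (X : Matrix (A × R) (A × R) ℂ) :
    (partialTr X 1).trace = X.trace := by
  simp [partialTr, Matrix.trace, Fintype.sum_prod_type, Matrix.one_apply]

theorem partialTr_posSemidef {X : Matrix (A × R) (A × R) ℂ} {Q : Matrix R R ℂ}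
    (hX : X.PosSemidef) (hQ : Q.PosSemidef) : (partialTr X Q).PosSemidef := by
  classical
  obtain ⟨B, rfl⟩ := CStarAlgebra.nonneg_iff_eq_star_mul_self.mp hQ.nonneg
  -- With `Q = B* B`, the operators `K s = 1 ⊗ (row s of B)` put the partial trace in Kraus form.
  let K : R → Matrix A (A × R) ℂ := fun s =>
    Matrix.of fun a p => if a = p.1 then B s p.2 else 0
  have h1 : ∀ s a p, (K s * X) a p = ∑ r, B s r * X (a, r) p := fun s a p => by
    rw [Matrix.mul_apply, Fintype.sum_prod_type,
      Finset.sum_eq_single a (fun b _ hb => by simp [K, Ne.symm hb]) (by simp)]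
    simp [K]
  have h2 : ∀ s a a', (K s * X * (K s)ᴴ) a a'
      = ∑ r', (∑ r, B s r * X (a, r) (a', r')) * star (B s r') := fun s a a' => by
    rw [Matrix.mul_apply, Fintype.sum_prod_type,
      Finset.sum_eq_single a' (fun b _ hb => by simp [K, Ne.symm hb]) (by simp)]
    simp [K, h1]
  have : partialTr X (star B * B) = ∑ s, K s * X * (K s)ᴴ := by
    ext a a'
    simp only [partialTr, Matrix.sum_apply, h2, Matrix.of_apply, Matrix.mul_apply,
      Matrix.star_apply, Finset.mul_sum, Finset.sum_mul]
    refine (Finset.sum_congr rfl fun r _ => Finset.sum_comm).trans (Finset.sum_comm.trans ?_)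
    refine Finset.sum_congr rfl fun s _ => Finset.sum_comm.trans ?_
    refine Finset.sum_congr rfl fun r' _ => Finset.sum_congr rfl fun r _ => ?_
    ring
  rw [this]
  exact posSemidef_sum _ fun s _ => hX.mul_mul_conjTranspose_same _

theorem partialTr_le_partialTr_one [DecidableEq R] {X : Matrix (A × R) (A × R) ℂ}
    {Q : Matrix R R ℂ} (hX : X.PosSemidef) (hQ : Q ≤ 1) : partialTr X Q ≤ partialTr X 1 := by
  have := partialTr_posSemidef hX hQ
  rwa [partialTr_sub] at this

end PartialTrace

/-! ### Diamond distance of measurement channels -/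

section Channel

open Matrix
open scoped Kronecker

variable {C : Type*} {m n : ℕ} {R : Type*}

/-- The diagonal block of `X` belonging to the classical input `y`. -/
def inputBlock (X : Matrix ((Fin m × C) × R) ((Fin m × C) × R) ℂ) (y : Fin m) :
    Matrix (C × R) (C × R) ℂ :=
  X.submatrix (fun p => ((y, p.1), p.2)) (fun p => ((y, p.1), p.2))

theorem sum_trace_inputBlock [Fintype C] [Fintype R]
    (X : Matrix ((Fin m × C) × R) ((Fin m × C) × R) ℂ) :
    ∑ y, (inputBlock X y).trace = X.trace := by
  simp [inputBlock, Matrix.trace, Fintype.sum_prod_type]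

/-- The vector `∑ c c', S c c' |y, c⟩ |y, c'⟩` on two copies of the input. -/
def inputVec (y : Fin m) (S : Matrix C C ℂ) : (Fin m × C) × (Fin m × C) → ℂ :=
  fun p => if p.1.1 = y then if p.2.1 = y then S p.1.2 p.2.2 else 0 else 0

/-- Steering: `inputVec y S` purifies `S Sᴴ` in the block `y`, and the effect `Bᵀ` on the reference
prepares `S B Sᴴ` on the input. -/
theorem partialTr_inputBlock_vecMulVec [Fintype C] (y y' : Fin m) (S B : Matrix C C ℂ) :
    partialTr (inputBlock (vecMulVec (inputVec y S) (star (inputVec y S))) y')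
      ((1 : Matrix (Fin m) (Fin m) ℂ) ⊗ₖ Bᵀ) = if y' = y then S * B * Sᴴ else 0 := by
  ext c c'
  by_cases h : y' = y
  · subst h
    simp [partialTr, inputBlock, inputVec, vecMulVec_apply, Fintype.sum_prod_type,
      Matrix.mul_apply, Finset.sum_mul, apply_ite, ite_mul, Matrix.one_apply, Finset.sum_ite_irrel]
    rw [Finset.sum_comm]
    refine Finset.sum_congr rfl fun j _ => Finset.sum_congr rfl fun i _ => ?_
    ring
  · simp [h, partialTr, inputBlock, inputVec, vecMulVec_apply]

variable [Fintype C] [DecidableEq C] (N N' : Fin m → Measurement C n)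

theorem tensorId_channel_sub_apply (X : Matrix ((Fin m × C) × R) ((Fin m × C) × R) ℂ)
    (x x' : Fin n) (s s' : R) :
    tensorId R (channel N - channel N') X (x, s) (x', s') = if x = x' then
      ∑ y, (Matrix.of (fun c c' => inputBlock X y (c, s) (c', s')) *
        ((N y).op x - (N' y).op x)).trace else 0 := by
  simp only [tensorId, Matrix.of_apply, LinearMap.sub_apply, Matrix.sub_apply, channel,
    LinearMap.coe_mk, AddHom.coe_mk, Matrix.diagonal_apply, Matrix.mul_sub, Matrix.trace_sub,
    Finset.sum_sub_distrib]
  split_ifs <;> simp [inputBlock]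

theorem isHermitian_tensorId_channel_sub
    {X : Matrix ((Fin m × C) × R) ((Fin m × C) × R) ℂ} (hX : X.IsHermitian) :
    (tensorId R (channel N - channel N') X).IsHermitian := by
  ext ⟨x, s⟩ ⟨x', s'⟩
  rw [Matrix.conjTranspose_apply, tensorId_channel_sub_apply, tensorId_channel_sub_apply]
  by_cases h : x = x'
  · subst h
    simp only [if_true, star_sum]
    refine Finset.sum_congr rfl fun y _ => ?_
    rw [← Matrix.trace_conjTranspose, Matrix.conjTranspose_mul, Matrix.trace_mul_comm,
      (((N y).posSemidef x).1.sub ((N' y).posSemidef x).1).eq]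
    congr 2
    ext c c'
    exact hX.apply _ _
  · simp [h, Ne.symm h]

variable [Fintype R]

theorem trace_tensorId_channel_sub_mul (X : Matrix ((Fin m × C) × R) ((Fin m × C) × R) ℂ)
    (P : Matrix (Fin n × R) (Fin n × R) ℂ) :
    (tensorId R (channel N - channel N') X * P).trace = ∑ x, ∑ y,
      (partialTr (inputBlock X y) (P.submatrix (Prod.mk x) (Prod.mk x)) *
        ((N y).op x - (N' y).op x)).trace := by
  rw [Matrix.trace]
  simp only [Matrix.diag_apply, Matrix.mul_apply, Fintype.sum_prod_type,
    tensorId_channel_sub_apply, ite_mul, zero_mul, trace_partialTr_mul, Matrix.submatrix_apply]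
  refine Finset.sum_congr rfl fun x _ => ?_
  refine (Finset.sum_congr rfl fun s _ => ?_).trans
    ((Finset.sum_congr rfl fun s _ => Finset.sum_comm).trans Finset.sum_comm)
  rw [Finset.sum_eq_single x (fun b _ hb => by simp [Ne.symm hb]) (by simp)]
  simp [Finset.sum_mul]

/-- Both families of effects sum to `1`, so the traces cancel. This removes the trace term from the
variational formula. -/
theorem trace_tensorId_channel_sub (X : Matrix ((Fin m × C) × R) ((Fin m × C) × R) ℂ) :
    (tensorId R (channel N - channel N') X).trace = 0 := by
  simp only [Matrix.trace, Matrix.diag_apply, Fintype.sum_prod_type, tensorId_channel_sub_apply,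
    if_true]
  rw [Finset.sum_comm]
  refine Finset.sum_eq_zero fun s _ => ?_
  rw [Finset.sum_comm]
  refine Finset.sum_eq_zero fun y _ => ?_
  have h := Matrix.trace_sum Finset.univ fun x : Fin n =>
    (Matrix.of (fun c c' => inputBlock X y (c, s) (c', s)) * ((N y).op x - (N' y).op x))
  rw [← Matrix.mul_sum, Finset.sum_sub_distrib, (N y).sum_eq_one, (N' y).sum_eq_one] at h
  simpa [Matrix.trace] using h.symm

/-- The trace norm of the output of a difference of channels, in terms of families of positive
operators whose members are dominated by operators of total trace one. -/
theorem exists_traceNorm_tensorId_channel_sub [DecidableEq R]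
    {X : Matrix ((Fin m × C) × R) ((Fin m × C) × R) ℂ} (hX : IsState X) :
    ∃ (σ : Fin m → Matrix C C ℂ) (W : Fin m → Fin n → Matrix C C ℂ),
      (∀ y, (σ y).PosSemidef) ∧ ∑ y, (σ y).trace.re = 1 ∧
      (∀ y x, (W y x).PosSemidef ∧ W y x ≤ σ y) ∧
      traceNorm (tensorId R (channel N - channel N') X)
        = 2 * ∑ y, ∑ x, (W y x * ((N y).op x - (N' y).op x)).trace.re := by
  have hH := isHermitian_tensorId_channel_sub N N' hX.1.1
  have hb : ∀ y, (inputBlock X y).PosSemidef := fun y => hX.1.submatrix _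
  obtain ⟨P, hP, hP1, hPT⟩ := exists_two_mul_trace_mul_eq_traceNorm hH
  have hsub : ∀ x, P.submatrix (Prod.mk x) (Prod.mk x) ≤ (1 : Matrix R R ℂ) := fun x => by
    have h1 : (1 : Matrix R R ℂ) - P.submatrix (Prod.mk x) (Prod.mk x)
        = (1 - P).submatrix (Prod.mk x) (Prod.mk x) := by
      ext s s'
      simp [Matrix.one_apply]
    rw [Matrix.le_iff, h1]
    exact PosSemidef.submatrix hP1 _
  -- `σ y` is the reduced block `y` of the input; `W y x` is its part steered by the diagonal block
  -- `x` of the optimal `P`.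
  refine ⟨fun y => partialTr (inputBlock X y) 1,
    fun y x => partialTr (inputBlock X y) (P.submatrix (Prod.mk x) (Prod.mk x)),
    fun y => partialTr_posSemidef (hb y) PosSemidef.one, ?_,
    fun y x => ⟨partialTr_posSemidef (hb y) (hP.submatrix _),
      partialTr_le_partialTr_one (hb y) (hsub x)⟩, ?_⟩
  · simp only [trace_partialTr_one]
    rw [← Complex.re_sum, sum_trace_inputBlock, hX.2, Complex.one_re]
  · rw [trace_tensorId_channel_sub, Complex.zero_re, add_zero,
      trace_tensorId_channel_sub_mul] at hPT
    rw [← hPT, Finset.sum_comm]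
    simp only [Complex.re_sum]

/-- Boundedness is needed for the supremum in `diamondNorm` to dominate its members. -/
theorem traceNorm_tensorId_channel_sub_le [DecidableEq R]
    {X : Matrix ((Fin m × C) × R) ((Fin m × C) × R) ℂ} (hX : IsState X) :
    traceNorm (tensorId R (channel N - channel N') X) ≤ 2 := by
  obtain ⟨σ, W, hσ, hσ1, hW, h⟩ := exists_traceNorm_tensorId_channel_sub N N' hX
  rw [h]
  suffices ∑ y, ∑ x, (W y x * ((N y).op x - (N' y).op x)).trace.re ≤ 1 by linarith
  rw [← hσ1]
  refine Finset.sum_le_sum fun y _ => ?_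
  calc ∑ x, (W y x * ((N y).op x - (N' y).op x)).trace.re
      ≤ ∑ x, (σ y * (N y).op x).trace.re := by
        refine Finset.sum_le_sum fun x _ => ?_
        have h1 := trace_mul_re_nonneg (hW y x).1 ((N' y).posSemidef x)
        have h2 := trace_mul_re_mono ((N y).posSemidef x) (hW y x).2
        rw [trace_re_mul_comm, trace_re_mul_comm _ (σ y)] at h2
        rw [Matrix.mul_sub, Matrix.trace_sub, Complex.sub_re]
        linarith
    _ = (σ y).trace.re := by
        rw [← Complex.re_sum, ← Matrix.trace_sum, ← Matrix.mul_sum, (N y).sum_eq_one,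
          Matrix.mul_one]

theorem traceNorm_le_diamondNorm
    {X : Matrix ((Fin m × C) × (Fin m × C)) ((Fin m × C) × (Fin m × C)) ℂ} (hX : IsState X) :
    traceNorm (tensorId (Fin m × C) (channel N - channel N') X)
      ≤ diamondNorm (channel N - channel N') := by
  refine le_csSup ⟨2, ?_⟩ ⟨X, hX, rfl⟩
  rintro _ ⟨X, hX, rfl⟩
  exact traceNorm_tensorId_channel_sub_le N N' hX

theorem sum_trace_le_diamondNorm (y : Fin m) {S : Matrix C C ℂ}
    (hS : (S * Sᴴ).trace = 1) {B : Fin n → Matrix C C ℂ} (hB : ∀ x, (B x).PosSemidef)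
    (hB1 : ∀ x, B x ≤ 1) :
    2 * ∑ x, (S * B x * Sᴴ * ((N y).op x - (N' y).op x)).trace.re
      ≤ diamondNorm (channel N - channel N') := by
  set X := vecMulVec (inputVec y S) (star (inputVec y S)) with hXdef
  have hX : IsState X := by
    refine ⟨posSemidef_vecMulVec_self_star _, ?_⟩
    have h1 : ∀ y', partialTr (inputBlock X y') 1 = if y' = y then S * Sᴴ else 0 := fun y' => by
      have := partialTr_inputBlock_vecMulVec y y' S 1
      rwa [Matrix.transpose_one, Matrix.one_kronecker_one, Matrix.mul_one] at this
    rw [← sum_trace_inputBlock]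
    simp only [← trace_partialTr_one, h1]
    rw [Finset.sum_eq_single y (fun y' _ h => by simp [h]) (by simp)]
    simpa using hS
  have hE : ∀ Q : Matrix C C ℂ, Q.PosSemidef → ∀ x : Fin n,
      ((Matrix.single x x (1 : ℂ)) ⊗ₖ ((1 : Matrix (Fin m) (Fin m) ℂ) ⊗ₖ Qᵀ)).PosSemidef := by
    intro Q hQ x
    refine PosSemidef.kronecker ?_ (PosSemidef.one.kronecker hQ.transpose)
    rw [← Matrix.diagonal_single]
    exact PosSemidef.diagonal (Pi.single_nonneg.mpr zero_le_one)
  -- A test controlled by the classical outcome: on seeing `x`, the effect `(B x)ᵀ` is applied to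
  -- the reference.
  set P : Matrix (Fin n × Fin m × C) (Fin n × Fin m × C) ℂ :=
    ∑ x, (Matrix.single x x (1 : ℂ)) ⊗ₖ ((1 : Matrix (Fin m) (Fin m) ℂ) ⊗ₖ (B x)ᵀ) with hPdef
  have hP : P.PosSemidef := posSemidef_sum _ fun x _ => hE _ (hB x) x
  have hP1 : P ≤ 1 := by
    have := posSemidef_sum Finset.univ fun x _ => hE _ (show (1 - B x).PosSemidef from hB1 x) x
    have h1 : (1 : Matrix (Fin n × Fin m × C) (Fin n × Fin m × C) ℂ) - P = ∑ x,
        (Matrix.single x x (1 : ℂ)) ⊗ₖ ((1 : Matrix (Fin m) (Fin m) ℂ) ⊗ₖ (1 - B x)ᵀ) := by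
      ext ⟨x, y₁, c₁⟩ ⟨x', y₂, c₂⟩
      by_cases h : x = x'
      · subst h
        by_cases hy : y₁ = y₂ <;>
          simp [hPdef, hy, Matrix.sum_apply, Matrix.single_apply, Matrix.one_apply]
      · have h' : ∀ z, ¬(z = x ∧ z = x') := fun z hz => h (hz.1.symm.trans hz.2)
        simp [hPdef, Matrix.sum_apply, Matrix.one_apply, h, h']
    rw [Matrix.le_iff, h1]
    exact this
  have hPx : ∀ x, P.submatrix (Prod.mk x) (Prod.mk x) =
      (1 : Matrix (Fin m) (Fin m) ℂ) ⊗ₖ (B x)ᵀ := by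
    intro x
    ext p p'
    simp [hPdef, Matrix.sum_apply, Matrix.single_apply]
  have h := two_mul_trace_mul_le_traceNorm
    (isHermitian_tensorId_channel_sub N N' hX.1.1) hP hP1
  rw [trace_tensorId_channel_sub, Complex.zero_re, add_zero,
    trace_tensorId_channel_sub_mul] at h
  refine le_trans (le_of_eq ?_) (h.trans (traceNorm_le_diamondNorm N N' hX))
  rw [Complex.re_sum]
  congr 1
  refine Finset.sum_congr rfl fun x _ => ?_
  simp only [hPx, hXdef, partialTr_inputBlock_vecMulVec]
  rw [Finset.sum_eq_single y (fun y' _ h => by simp [h]) (by simp)]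
  simp

end Channel

/-! ### Guessing probabilities and ensembles -/

section Guessing

open Matrix

variable {C : Type*} [Fintype C] [DecidableEq C] {r l n : ℕ}

theorem Ensemble.nonempty_fin {C : Type*} [Fintype C] {r : ℕ} (E : Ensemble C r) : Nonempty (Fin r) := by
  by_contra h
  rw [not_nonempty_iff] at h
  simpa using E.prob_mem.2

/-- The measurement obtained from `M` by postprocessing its outcomes with `p`. -/
noncomputable def Measurement.post (M : Measurement C l) {p : Fin l → Fin n → ℝ}
    (hp : IsCondProb p) : Measurement C n where
  op x := ∑ j, p j x • M.op j
  posSemidef x := posSemidef_sum _ fun j _ => (M.posSemidef j).smul ((hp j).1 x)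
  sum_eq_one := by
    rw [Finset.sum_comm]
    simp only [← Finset.sum_smul, (hp _).2, one_smul, M.sum_eq_one]

theorem succProbPost_eq (E : Ensemble C r) (M : Measurement C l) (p : Fin l → Fin r → ℝ) :
    succProbPost E M p = ∑ x, (E.weighted x * ∑ j, p j x • M.op j).trace.re := by
  refine Finset.sum_congr rfl fun x _ => ?_
  rw [Matrix.mul_sum, trace_sum, Complex.re_sum]
  refine Finset.sum_congr rfl fun j _ => ?_
  rw [Matrix.mul_smul, trace_smul, Complex.smul_re, E.trace_weighted_mul, smul_eq_mul]
  ring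

theorem bddAbove_succProbPost (E : Ensemble C r) (M : Measurement C l) :
    BddAbove {t | ∃ p : Fin l → Fin r → ℝ, IsCondProb p ∧ t = succProbPost E M p} := by
  refine ⟨succProb E, ?_⟩
  rintro _ ⟨p, hp, rfl⟩
  have := succProbWith_le_succProb E (M.post hp)
  rw [succProbWith_eq] at this
  rw [succProbPost_eq]
  exact this

theorem succProbPost_le_succProbQ (E : Ensemble C r) (M : Measurement C l)
    {p : Fin l → Fin r → ℝ} (hp : IsCondProb p) : succProbPost E M p ≤ succProbQ E M :=
  le_csSup (bddAbove_succProbPost E M) ⟨p, hp, rfl⟩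

theorem Measurement.nonempty_fin [Nonempty C] (F : Measurement C r) : Nonempty (Fin r) := by
  by_contra h
  rw [not_nonempty_iff] at h
  simpa using F.sum_eq_one

theorem exists_succProbQ_eq (E : Ensemble C r) (M : Measurement C l) :
    ∃ p, IsCondProb p ∧ succProbQ E M = succProbPost E M p := by
  obtain ⟨x₀⟩ := E.nonempty_fin
  have hcomp : IsCompact (Set.pi Set.univ fun _ : Fin l => stdSimplex ℝ (Fin r)) :=
    isCompact_univ_pi fun _ => isCompact_stdSimplex ℝ (Fin r)
  obtain ⟨p, hp, hmax⟩ := hcomp.exists_isMaxOn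
    ⟨fun _ => Pi.single x₀ 1, fun _ _ => single_mem_stdSimplex ℝ x₀⟩
    (f := succProbPost E M) (by unfold succProbPost; fun_prop)
  have hp' : IsCondProb p := fun j => hp j trivial
  refine ⟨p, hp', le_antisymm (csSup_le ⟨_, p, hp', rfl⟩ ?_) (succProbPost_le_succProbQ E M hp')⟩
  rintro _ ⟨p', hp', rfl⟩
  exact hmax fun j _ => hp' j

theorem succProbWith_le_succProbQ (E : Ensemble C r) (F : Measurement C r) :
    succProbWith E F ≤ succProbQ E F := by
  refine le_of_eq_of_le ?_ (succProbPost_le_succProbQ E F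
    (p := fun j => Pi.single j 1) fun j => single_mem_stdSimplex ℝ j)
  rw [succProbWith_eq, succProbPost_eq]
  simp [Pi.single_apply]

theorem exists_ensemble_weighted [Nonempty C] {A : Fin r → Matrix C C ℂ}
    (hA : ∀ x, (A x).PosSemidef) {c : ℝ} (hc : 0 < c) (hcA : ∑ x, (A x).trace.re = c) :
    ∃ E : Ensemble C r, ∀ x, c • E.weighted x = A x := by
  have htr : ∀ x, ((A x).trace.re : ℂ) = (A x).trace ∧ 0 ≤ (A x).trace.re := fun x => by
    have := Complex.nonneg_iff.mp (hA x).trace_nonneg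
    exact ⟨Complex.ext rfl this.2, this.1⟩
  refine ⟨⟨fun x => c⁻¹ * (A x).trace.re, ⟨fun x => mul_nonneg (by positivity) (htr x).2, ?_⟩,
    -- A member of trace zero vanishes and gets probability zero, so any state serves there.
    fun x => if (A x).trace = 0 then ((Fintype.card C : ℝ)⁻¹) • 1 else (A x).trace.re⁻¹ • A x,
    fun x => ?_⟩, fun x => ?_⟩
  · rw [← Finset.mul_sum, hcA, inv_mul_cancel₀ hc.ne']
  · split_ifs with h
    · exact isState_smul_one
    · refine ⟨(hA x).smul (inv_nonneg.mpr (htr x).2), ?_⟩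
      rw [trace_smul, Complex.real_smul, Complex.ofReal_inv, (htr x).1, inv_mul_cancel₀ h]
  · simp only [Ensemble.weighted]
    split_ifs with h
    · rw [(hA x).trace_eq_zero_iff.mp h]
      simp
    · have h' : (A x).trace.re ≠ 0 := fun h0 => h (by rw [← (htr x).1, h0, Complex.ofReal_zero])
      rw [smul_smul, smul_smul]
      field_simp
      simp

end Guessing

/-! ### Necessity -/

section Simulation

open Matrix

variable {C : Type*} [Fintype C] [DecidableEq C] {k l m n r : ℕ}

/-- With `s = Tr σ` and `σ / s = Tᴴ T`, `T` invertible, conjugating `A x / s` by `T⁻¹` gives effects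
`B x ≤ 1`. Steering the purification with `S = Tᴴ` by `B x` returns `A x / s`. -/
theorem two_mul_sum_trace_le_of_posDef (N N' : Fin m → Measurement C n) (y : Fin m) [Nonempty C]
    {σ : Matrix C C ℂ} (hσ : σ.PosDef) {A : Fin n → Matrix C C ℂ} (hA : ∀ x, (A x).PosSemidef)
    (hAσ : ∀ x, A x ≤ σ) :
    2 * ∑ x, (A x * ((N y).op x - (N' y).op x)).trace.re
      ≤ σ.trace.re * diamondNorm (channel N - channel N') := by
  have hs := hσ.trace_pos
  obtain ⟨s, hs, hsσ⟩ : ∃ s : ℝ, 0 < s ∧ σ.trace = (s : ℂ) :=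
    ⟨σ.trace.re, (Complex.pos_iff.mp hs).1, Complex.ext rfl (Complex.pos_iff.mp hs).2.symm⟩
  have hσ' : (s⁻¹ • σ).PosDef := hσ.smul (by positivity)
  obtain ⟨T, hT⟩ := CStarAlgebra.nonneg_iff_eq_star_mul_self.mp hσ'.posSemidef.nonneg
  rw [Matrix.star_eq_conjTranspose] at hT
  have hu : IsUnit T := by
    have := hσ'.isUnit
    rw [hT, Matrix.isUnit_iff_isUnit_det, Matrix.det_mul] at this
    exact (Matrix.isUnit_iff_isUnit_det T).mpr (isUnit_of_mul_isUnit_right this)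
  have hd := (Matrix.isUnit_iff_isUnit_det T).mp hu
  have hd' : IsUnit Tᴴ.det := by
    rw [Matrix.det_conjTranspose]
    exact hd.star
  have hconj : ∀ X : Matrix C C ℂ, X.PosSemidef → (Tᴴ⁻¹ * X * T⁻¹).PosSemidef := fun X hX => by
    have := hX.conjTranspose_mul_mul_same T⁻¹
    rwa [Matrix.conjTranspose_nonsing_inv] at this
  have h := sum_trace_le_diamondNorm N N' y (S := Tᴴ)
    (by rw [conjTranspose_conjTranspose, ← hT, trace_smul, hsσ, Complex.real_smul,
      Complex.ofReal_inv, inv_mul_cancel₀ (by exact_mod_cast hs.ne')])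
    (B := fun x => Tᴴ⁻¹ * (s⁻¹ • A x) * T⁻¹)
    (fun x => hconj _ ((hA x).smul (by positivity))) (fun x => by
      have h1 := hconj _ ((show (σ - A x).PosSemidef from hAσ x).smul
        (inv_nonneg.mpr hs.le : (0 : ℝ) ≤ s⁻¹))
      rw [smul_sub, Matrix.mul_sub, Matrix.sub_mul, hT, ← Matrix.mul_assoc Tᴴ⁻¹,
        Matrix.nonsing_inv_mul _ hd', Matrix.one_mul, Matrix.mul_nonsing_inv _ hd] at h1
      exact h1)
  have h2 : ∀ x, Tᴴ * (Tᴴ⁻¹ * (s⁻¹ • A x) * T⁻¹) * Tᴴᴴ = s⁻¹ • A x := fun x => by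
    rw [conjTranspose_conjTranspose, Matrix.mul_assoc Tᴴ⁻¹, Matrix.mul_nonsing_inv_cancel_left _ _ hd',
      Matrix.nonsing_inv_mul_cancel_right _ _ hd]
  simp only [h2, Matrix.smul_mul, trace_smul, Complex.smul_re, smul_eq_mul,
    ← Finset.mul_sum] at h
  rw [hsσ, Complex.ofReal_re]
  rw [← inv_mul_le_iff₀ hs]
  linarith

theorem two_mul_sum_trace_le (N N' : Fin m → Measurement C n) (y : Fin m) [Nonempty C]
    {σ : Matrix C C ℂ} (hσ : σ.PosSemidef) {A : Fin n → Matrix C C ℂ}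
    (hA : ∀ x, (A x).PosSemidef) (hAσ : ∀ x, A x ≤ σ) :
    2 * ∑ x, (A x * ((N y).op x - (N' y).op x)).trace.re
      ≤ σ.trace.re * diamondNorm (channel N - channel N') := by
  -- A singular `σ` is replaced by the positive definite `σ + δ • 1`, and `δ` tends to `0` from
  -- above.
  have hlim : Filter.Tendsto (fun δ : ℝ => (σ + δ • (1 : Matrix C C ℂ)).trace.re *
      diamondNorm (channel N - channel N')) (nhdsWithin 0 (Set.Ioi 0))
      (nhds (σ.trace.re * diamondNorm (channel N - channel N'))) := by
    have : Continuous fun δ : ℝ => (σ + δ • (1 : Matrix C C ℂ)).trace.re *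
      diamondNorm (channel N - channel N') := by fun_prop
    simpa using (this.tendsto 0).mono_left nhdsWithin_le_nhds
  refine ge_of_tendsto hlim (eventually_nhdsWithin_of_forall fun δ hδ => ?_)
  have h1 : (δ • (1 : Matrix C C ℂ)).PosDef := PosDef.one.smul hδ
  exact two_mul_sum_trace_le_of_posDef N N' y (h1.posSemidef_add hσ) hA
    fun x => (hAσ x).trans (le_add_of_nonneg_right h1.posSemidef.nonneg)

/-- Postprocessings compose, and the success probability is linear in the measurement, so a
simulated measurement yields a convex combination of values of the `M i`. -/
theorem succProbPost_le_of_simulates {M : Fin k → Measurement C l} {N : Fin m → Measurement C n}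
    (h : Simulates M N) (y : Fin m) (E : Ensemble C r) {p : Fin n → Fin r → ℝ}
    (hp : IsCondProb p) : succProbPost E (N y) p ≤ ⨆ i, succProbQ E (M i) := by
  obtain ⟨q, hq, p', hp', hN⟩ := h y
  have hcomp : ∀ i, IsCondProb fun j x => ∑ z, p' i j z * p z x := fun i j => by
    refine ⟨fun x => Finset.sum_nonneg fun z _ => mul_nonneg ((hp' i j).1 z) ((hp z).1 x), ?_⟩
    rw [Finset.sum_comm]
    simp only [← Finset.mul_sum, (hp _).2, mul_one, (hp' i j).2]
  have heq : succProbPost E (N y) p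
      = ∑ i, q i * succProbPost E (M i) fun j x => ∑ z, p' i j z * p z x := by
    simp only [succProbPost_eq, Finset.mul_sum]
    rw [Finset.sum_comm]
    refine Finset.sum_congr rfl fun x _ => ?_
    have : ∑ z, p z x • (N y).op z = ∑ i, q i • ∑ j, (∑ z, p' i j z * p z x) • (M i).op j := by
      simp only [hN, Finset.smul_sum, Finset.sum_smul, smul_smul]
      rw [Finset.sum_comm]
      refine Finset.sum_congr rfl fun i _ => ?_
      rw [Finset.sum_comm]
      refine Finset.sum_congr rfl fun j _ => Finset.sum_congr rfl fun z _ => ?_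
      congr 1
      ring
    simp only [← Matrix.mul_sum]
    rw [this, Matrix.mul_sum, trace_sum, Complex.re_sum]
    simp only [Matrix.mul_smul, trace_smul, Complex.smul_re, smul_eq_mul]
  rw [heq]
  calc ∑ i, q i * succProbPost E (M i) (fun j x => ∑ z, p' i j z * p z x)
      ≤ ∑ i, q i * ⨆ i, succProbQ E (M i) :=
        Finset.sum_le_sum fun i _ => mul_le_mul_of_nonneg_left
          ((succProbPost_le_succProbQ E (M i) (hcomp i)).trans
            (le_ciSup (f := fun i => succProbQ E (M i)) (Set.finite_range _).bddAbove i)) (hq.1 i)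
    _ = ⨆ i, succProbQ E (M i) := by rw [← Finset.sum_mul, hq.2, one_mul]

theorem succProb_nonneg [Nonempty C] (E : Ensemble C r) : 0 ≤ succProb E := by
  obtain ⟨x₀⟩ := E.nonempty_fin
  obtain ⟨F, -⟩ := exists_measurement_ge (C := C) x₀ (G := fun _ => 0)
    (fun _ => PosSemidef.zero) (by simp)
  refine le_trans ?_ (succProbWith_le_succProb E F)
  rw [succProbWith_eq]
  exact Finset.sum_nonneg fun x _ =>
    trace_mul_re_nonneg (E.weighted_posSemidef x) (F.posSemidef x)

theorem iSup_succProbQ_le_of_isSimulable [Nonempty C] (hm : 0 < m) {ε : ℝ}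
    {M : Fin k → Measurement C l} {N : Fin m → Measurement C n} (h : IsSimulable ε N M)
    (E : Ensemble C r) :
    (⨆ y, succProbQ E (N y)) ≤ (⨆ i, succProbQ E (M i)) + ε / 2 * succProb E := by
  have : Nonempty (Fin m) := ⟨⟨0, hm⟩⟩
  obtain ⟨N', hsim, hd⟩ := h
  refine ciSup_le fun y => ?_
  obtain ⟨p, hp, hpQ⟩ := exists_succProbQ_eq E (N y)
  obtain ⟨σ, hσ, hle⟩ := exists_isState_weighted_le E
  have ht := succProb_nonneg E
  have h1 := succProbPost_le_of_simulates hsim y E hp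
  -- Averaging over the guess made on outcome `z` keeps the bound `succProb E • σ`, since `p z` sums
  -- to `1`.
  have h2 := two_mul_sum_trace_le N N' y (hσ.1.smul ht) (A := fun z => ∑ x, p z x • E.weighted x)
    (fun z => posSemidef_sum _ fun x _ => (E.weighted_posSemidef x).smul ((hp z).1 x))
    (fun z => by
      calc ∑ x, p z x • E.weighted x ≤ ∑ x, p z x • (succProb E • σ) :=
            Finset.sum_le_sum fun x _ => smul_le_smul_of_nonneg_left (hle x) ((hp z).1 x)
        _ = succProb E • σ := by rw [← Finset.sum_smul, (hp z).2, one_smul])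
  have h3 : ∀ F : Measurement C n, succProbPost E F p
      = ∑ z, ((∑ x, p z x • E.weighted x) * F.op z).trace.re := fun F => by
    simp only [succProbPost_eq, Matrix.mul_sum, Matrix.sum_mul, trace_sum, Complex.re_sum,
      Matrix.mul_smul, Matrix.smul_mul]
    rw [Finset.sum_comm]
  simp only [Matrix.mul_sub, trace_sub, Complex.sub_re, Finset.sum_sub_distrib, ← h3] at h2
  rw [trace_smul, hσ.2, Complex.smul_re, Complex.one_re, smul_eq_mul, mul_one] at h2
  have h4 := mul_le_mul_of_nonneg_left hd ht
  rw [hpQ]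
  linarith

end Simulation

/-! ### Sufficiency -/

section Sufficiency

open Matrix

variable {C : Type*} [Fintype C] [DecidableEq C] {k l m n : ℕ}

/-- Weights `w i j x = q i * p i j x` of a randomized choice and postprocessing of `k` measurements
with `l` outcomes. -/
def simulationWeights (k l n : ℕ) : Set ((Fin k → ℝ) × (Fin k → Fin l → Fin n → ℝ)) :=
  {v | v.1 ∈ stdSimplex ℝ (Fin k) ∧
    ∀ i j, (∀ x, 0 ≤ v.2 i j x) ∧ ∑ x, v.2 i j x = v.1 i}

/-- The products `q i * p i j x` are not affine in `(q, p)` jointly. Taking them as the variables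
makes the simulated operators linear, as minimax requires. -/
theorem convex_simulationWeights : Convex ℝ (simulationWeights k l n) := by
  refine fun v hv v' hv' a b ha hb hab =>
    ⟨convex_stdSimplex ℝ _ hv.1 hv'.1 ha hb hab, fun i j => ⟨fun x => ?_, ?_⟩⟩
  · exact add_nonneg (mul_nonneg ha ((hv.2 i j).1 x)) (mul_nonneg hb ((hv'.2 i j).1 x))
  · simp [Finset.sum_add_distrib, ← Finset.mul_sum, (hv.2 i j).2, (hv'.2 i j).2]

theorem isCompact_simulationWeights : IsCompact (simulationWeights k l n) := by
  have hK : IsCompact (stdSimplex ℝ (Fin k) ×ˢ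
      Set.pi Set.univ fun _ : Fin k => Set.pi Set.univ fun _ : Fin l => Set.pi Set.univ
        fun _ : Fin n => Set.Icc (0 : ℝ) 1) :=
    (isCompact_stdSimplex ℝ _).prod <| isCompact_univ_pi fun _ => isCompact_univ_pi fun _ =>
      isCompact_univ_pi fun _ => isCompact_Icc
  refine hK.of_isClosed_subset ?_ fun v hv => ⟨hv.1, fun i _ j _ x _ => ⟨(hv.2 i j).1 x, ?_⟩⟩
  · simp only [simulationWeights, Set.ofPred_and, Set.ofPred_forall]
    refine ((isClosed_stdSimplex ℝ _).preimage continuous_fst).inter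
      (isClosed_iInter fun i => isClosed_iInter fun j => (isClosed_iInter fun x => ?_).inter ?_)
    · exact isClosed_le continuous_const (by fun_prop)
    · exact isClosed_eq (by fun_prop) (by fun_prop)
  · calc v.2 i j x ≤ ∑ x, v.2 i j x :=
          Finset.single_le_sum (fun x _ => (hv.2 i j).1 x) (Finset.mem_univ x)
      _ = v.1 i := (hv.2 i j).2
      _ ≤ ∑ i, v.1 i := Finset.single_le_sum (fun i _ => hv.1.1 i) (Finset.mem_univ i)
      _ = 1 := hv.1.2

theorem mem_simulationWeights_of_isCondProb {q : Fin k → ℝ} (hq : q ∈ stdSimplex ℝ (Fin k))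
    {p : Fin k → Fin l → Fin n → ℝ} (hp : ∀ i, IsCondProb (p i)) :
    (q, fun i j x => q i * p i j x) ∈ simulationWeights k l n :=
  ⟨hq, fun i j => ⟨fun x => mul_nonneg (hq.1 i) ((hp i j).1 x), by
    rw [← Finset.mul_sum, (hp i j).2, mul_one]⟩⟩

theorem exists_isCondProb_of_mem_simulationWeights [Nonempty (Fin n)]
    {v : (Fin k → ℝ) × (Fin k → Fin l → Fin n → ℝ)} (hv : v ∈ simulationWeights k l n) :
    ∃ p : Fin k → Fin l → Fin n → ℝ, (∀ i, IsCondProb (p i)) ∧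
      ∀ i j x, v.2 i j x = v.1 i * p i j x := by
  obtain ⟨x₀⟩ := ‹Nonempty (Fin n)›
  -- If `q i = 0`, all weights at `i` vanish, and any postprocessing will do.
  refine ⟨fun i j => if v.1 i = 0 then Pi.single x₀ 1 else fun x => (v.1 i)⁻¹ * v.2 i j x,
    fun i j => ?_, fun i j x => ?_⟩
  · dsimp only
    split_ifs with h
    · exact single_mem_stdSimplex ℝ x₀
    · refine ⟨fun x => mul_nonneg (inv_nonneg.mpr (hv.1.1 i)) ((hv.2 i j).1 x), ?_⟩
      rw [← Finset.mul_sum, (hv.2 i j).2, inv_mul_cancel₀ h]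
  · dsimp only
    split_ifs with h
    · rw [h, zero_mul]
      exact (Finset.sum_eq_zero_iff_of_nonneg fun x _ => (hv.2 i j).1 x).mp
        ((hv.2 i j).2.trans h) x (Finset.mem_univ x)
    · rw [mul_inv_cancel_left₀ h]

/-- The operators of the measurement simulated by `M` with the weights `w`. -/
noncomputable def simulatedOp (M : Fin k → Measurement C l) (w : Fin k → Fin l → Fin n → ℝ) (x : Fin n) :
    Matrix C C ℂ :=
  ∑ i, ∑ j, w i j x • (M i).op j

theorem exists_measurement_simulatedOp (M : Fin k → Measurement C l)
    {v : (Fin k → ℝ) × (Fin k → Fin l → Fin n → ℝ)} (hv : v ∈ simulationWeights k l n) :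
    ∃ F : Measurement C n, ∀ x, F.op x = simulatedOp M v.2 x := by
  refine ⟨⟨simulatedOp M v.2, fun x => posSemidef_sum _ fun i _ => posSemidef_sum _ fun j _ =>
    ((M i).posSemidef j).smul ((hv.2 i j).1 x), ?_⟩, fun x => rfl⟩
  simp only [simulatedOp]
  rw [Finset.sum_comm]
  have : ∀ i, ∑ x, ∑ j, v.2 i j x • (M i).op j = v.1 i • (1 : Matrix C C ℂ) := fun i => by
    rw [Finset.sum_comm]
    simp only [← Finset.sum_smul, (hv.2 i _).2, ← Finset.smul_sum, (M i).sum_eq_one]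
  simp only [this, ← Finset.sum_smul, hv.1.2, one_smul]

/-- Weak duality: `∑ Tr(λ_x ρ_x F_x) ≤ ∑ Tr(σ F_x) = Tr σ`. -/
theorem succProb_le_of_weighted_le [Nonempty C] {r : ℕ} (E : Ensemble C r) {σ : Matrix C C ℂ}
    (h : ∀ x, E.weighted x ≤ σ) : succProb E ≤ σ.trace.re := by
  obtain ⟨x₀⟩ := E.nonempty_fin
  obtain ⟨F, -⟩ := exists_measurement_ge (C := C) x₀ (G := fun _ => 0)
    (fun _ => PosSemidef.zero) (by simp)
  refine csSup_le ⟨_, F, rfl⟩ ?_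
  rintro _ ⟨F, rfl⟩
  rw [succProbWith_eq]
  calc ∑ x, (E.weighted x * F.op x).trace.re ≤ ∑ x, (σ * F.op x).trace.re :=
        Finset.sum_le_sum fun x _ => by
          rw [trace_re_mul_comm, trace_re_mul_comm σ]
          exact trace_mul_re_mono (F.posSemidef x) (h x)
    _ = σ.trace.re := by
        rw [← Complex.re_sum, ← trace_sum, ← Matrix.mul_sum, F.sum_eq_one, Matrix.mul_one]

/-- The reply to one family `A`. Dividing by `c = ∑ Tr A_x > 0` gives an ensemble with `c * succProb
≤ Tr σ` by weak duality; the reply is the best `M i` with its best postprocessing. If `c = 0`, then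
`A = 0` and any weights work. -/
theorem exists_simulationWeights_le [Nonempty C] (hk : 0 < k) {ε : ℝ} (hε : 0 ≤ ε)
    (M : Fin k → Measurement C l) (F : Measurement C n)
    (h : ∀ E : Ensemble C n, succProbQ E F ≤ (⨆ i, succProbQ E (M i)) + ε / 2 * succProb E)
    {σ : Matrix C C ℂ} {A : Fin n → Matrix C C ℂ} (hA : ∀ x, (A x).PosSemidef ∧ A x ≤ σ) :
    ∃ v ∈ simulationWeights k l n,
      ∑ x, (A x * (F.op x - simulatedOp M v.2 x)).trace.re ≤ ε / 2 * σ.trace.re := by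
  have : Nonempty (Fin k) := ⟨⟨0, hk⟩⟩
  obtain ⟨x₀⟩ := F.nonempty_fin
  have hσ : σ.PosSemidef := ((hA x₀).1.nonneg.trans (hA x₀).2).posSemidef
  have hσ0 : 0 ≤ σ.trace.re := (Complex.nonneg_iff.mp hσ.trace_nonneg).1
  have htr : ∀ x, 0 ≤ (A x).trace.re := fun x =>
    (Complex.nonneg_iff.mp (hA x).1.trace_nonneg).1
  have hc0 : 0 ≤ ∑ x, (A x).trace.re := Finset.sum_nonneg fun x _ => htr x
  obtain ⟨c, hc⟩ : ∃ c, ∑ x, (A x).trace.re = c := ⟨_, rfl⟩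
  rw [hc] at hc0
  rcases hc0.eq_or_lt with rfl | hcpos
  · have hA0 : ∀ x, A x = 0 := fun x => by
      have h1 := (Finset.sum_eq_zero_iff_of_nonneg fun x _ => htr x).mp hc x (Finset.mem_univ x)
      refine (hA x).1.trace_eq_zero_iff.mp (Complex.ext h1 ?_)
      exact (Complex.nonneg_iff.mp (hA x).1.trace_nonneg).2.symm
    refine ⟨_, mem_simulationWeights_of_isCondProb (single_mem_stdSimplex ℝ ⟨0, hk⟩)
      (p := fun _ _ => Pi.single x₀ 1) (fun _ _ => single_mem_stdSimplex ℝ x₀), ?_⟩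
    simp only [hA0, Matrix.zero_mul, trace_zero, Complex.zero_re, Finset.sum_const_zero]
    positivity
  · obtain ⟨E, hE⟩ := exists_ensemble_weighted (fun x => (hA x).1) hcpos hc
    obtain ⟨i, hi⟩ := exists_eq_ciSup_of_finite (f := fun i => succProbQ E (M i))
    obtain ⟨p, hp, hpQ⟩ := exists_succProbQ_eq E (M i)
    refine ⟨_, mem_simulationWeights_of_isCondProb (single_mem_stdSimplex ℝ i)
      (p := fun _ => p) (fun _ => hp), ?_⟩
    have hop : ∀ x, simulatedOp M (fun i' j x => (Pi.single i 1 : Fin k → ℝ) i' * p j x) x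
        = ∑ j, p j x • (M i).op j := fun x => by
      rw [simulatedOp, Finset.sum_eq_single i (fun b _ hb => by simp [hb]) (by simp)]
      simp
    have h1 := (succProbWith_le_succProbQ E F).trans (h E)
    rw [← hi] at h1
    simp only [hpQ, succProbPost_eq, succProbWith_eq] at h1
    have h2 : succProb E ≤ c⁻¹ * σ.trace.re := by
      refine (succProb_le_of_weighted_le E (σ := c⁻¹ • σ) fun x => ?_).trans_eq ?_
      · have := smul_le_smul_of_nonneg_left (hA x).2 (inv_nonneg.mpr hcpos.le)
        rwa [← hE, smul_smul, inv_mul_cancel₀ hcpos.ne', one_smul] at this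
      · simp
    have h3 : c * (ε / 2 * succProb E) ≤ ε / 2 * σ.trace.re := by
      have := mul_le_mul_of_nonneg_left h2 (mul_nonneg hcpos.le (by positivity : 0 ≤ ε / 2))
      have h4 : c * (ε / 2) * (c⁻¹ * σ.trace.re) = ε / 2 * σ.trace.re := by
        field_simp
      linarith
    have h5 := mul_le_mul_of_nonneg_left h1 hcpos.le
    simp only [hop, ← hE, Matrix.smul_mul, trace_smul, Complex.smul_re, smul_eq_mul,
      ← Finset.mul_sum, Matrix.mul_sub, trace_sub, Complex.sub_re, Finset.sum_sub_distrib]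
    linarith

/-- Minimax exchanges the quantifiers: the reply no longer depends on `(σ, A)`. The pairs `(σ, A)`
form a noncompact cone, so only the weights are compact. -/
theorem exists_simulated_le [Nonempty C] (hk : 0 < k) {ε : ℝ} (hε : 0 ≤ ε)
    (M : Fin k → Measurement C l) (F : Measurement C n)
    (h : ∀ E : Ensemble C n, succProbQ E F ≤ (⨆ i, succProbQ E (M i)) + ε / 2 * succProb E) :
    ∃ F' : Measurement C n,
      (∃ q ∈ stdSimplex ℝ (Fin k), ∃ p : Fin k → Fin l → Fin n → ℝ, (∀ i, IsCondProb (p i)) ∧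
        ∀ x, F'.op x = ∑ i, q i • ∑ j, p i j x • (M i).op j) ∧
      ∀ (σ : Matrix C C ℂ) (A : Fin n → Matrix C C ℂ), (∀ x, (A x).PosSemidef ∧ A x ≤ σ) →
        ∑ x, (A x * (F.op x - F'.op x)).trace.re ≤ ε / 2 * σ.trace.re := by
  obtain ⟨x₀⟩ := F.nonempty_fin
  have : Nonempty (Fin n) := ⟨x₀⟩
  suffices hv : ∃ v ∈ simulationWeights k l n, ∀ z ∈ {z : Matrix C C ℂ × (Fin n → Matrix C C ℂ) |
      ∀ x, (z.2 x).PosSemidef ∧ z.2 x ≤ z.1},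
      ∑ x, (z.2 x * (F.op x - simulatedOp M v.2 x)).trace.re - ε / 2 * z.1.trace.re ≤ 0 by
    obtain ⟨v, hv, hle⟩ := hv
    obtain ⟨F', hF'⟩ := exists_measurement_simulatedOp M hv
    obtain ⟨p, hp, hpv⟩ := exists_isCondProb_of_mem_simulationWeights hv
    refine ⟨F', ⟨v.1, hv.1, p, hp, fun x => ?_⟩, fun σ A hA => ?_⟩
    · simp only [hF', simulatedOp, hpv, Finset.smul_sum, smul_smul]
    · have := hle (σ, A) hA
      simp only [hF']
      linarith
  refine exists_forall_le_of_forall_exists_le (X := simulationWeights k l n)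
    (Y := {z : Matrix C C ℂ × (Fin n → Matrix C C ℂ) | ∀ x, (z.2 x).PosSemidef ∧ z.2 x ≤ z.1})
    (f := fun v z =>
      ∑ x, (z.2 x * (F.op x - simulatedOp M v.2 x)).trace.re - ε / 2 * z.1.trace.re)
    isCompact_simulationWeights convex_simulationWeights
    ⟨_, mem_simulationWeights_of_isCondProb (single_mem_stdSimplex ℝ ⟨0, hk⟩)
      (p := fun _ _ => Pi.single x₀ 1) (fun _ _ => single_mem_stdSimplex ℝ x₀)⟩
    ?_ ?_ ?_ ?_ ?_ ?_
  · refine fun z hz z' hz' a b ha hb hab x =>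
      ⟨convex_posSemidef (hz x).1 (hz' x).1 ha hb hab, ?_⟩
    exact add_le_add (smul_le_smul_of_nonneg_left (hz x).2 ha)
      (smul_le_smul_of_nonneg_left (hz' x).2 hb)
  · intro z
    simp only [simulatedOp]
    fun_prop
  · intro v
    fun_prop
  · intro v v' z a b hab
    have h1 : ∀ x, simulatedOp M (a • v + b • v').2 x
        = a • simulatedOp M v.2 x + b • simulatedOp M v'.2 x := fun x => by
      simp only [simulatedOp, Finset.smul_sum, smul_smul, ← Finset.sum_add_distrib, ← add_smul]
      rfl
    have h2 : ∀ x, (z.2 x * (F.op x - simulatedOp M (a • v + b • v').2 x)).trace.re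
        = a * (z.2 x * (F.op x - simulatedOp M v.2 x)).trace.re
          + b * (z.2 x * (F.op x - simulatedOp M v'.2 x)).trace.re := fun x => by
      simp only [h1, Matrix.mul_sub, Matrix.mul_add, Matrix.mul_smul, trace_sub, trace_add,
        trace_smul, Complex.sub_re, Complex.add_re, Complex.smul_re, smul_eq_mul]
      linear_combination -(z.2 x * F.op x).trace.re * hab
    simp only [h2, Finset.sum_add_distrib, ← Finset.mul_sum]
    linear_combination (ε / 2 * z.1.trace.re) * hab
  · intro v z z' a b hab
    have h2 : ∀ x, ((a • z + b • z').2 x * (F.op x - simulatedOp M v.2 x)).trace.re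
        = a * (z.2 x * (F.op x - simulatedOp M v.2 x)).trace.re
          + b * (z'.2 x * (F.op x - simulatedOp M v.2 x)).trace.re := fun x => by
      simp only [Prod.snd_add, Prod.smul_snd, Pi.add_apply, Pi.smul_apply, Matrix.add_mul,
        Matrix.smul_mul, trace_add, trace_smul, Complex.add_re, Complex.smul_re, smul_eq_mul]
    simp only [h2, Finset.sum_add_distrib, ← Finset.mul_sum, Prod.fst_add, Prod.smul_fst,
      trace_add, trace_smul, Complex.add_re, Complex.smul_re, smul_eq_mul]
    ring
  · intro z hz
    obtain ⟨v, hv, hle⟩ := exists_simulationWeights_le hk hε M F h hz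
    exact ⟨v, hv, by linarith⟩

theorem isSimulable_of_forall_iSup_succProbQ_le [Nonempty C] (hk : 0 < k) (hm : 0 < m) {ε : ℝ}
    (hε : 0 ≤ ε) (M : Fin k → Measurement C l) (N : Fin m → Measurement C n)
    (h : ∀ E : Ensemble C n,
      (⨆ y, succProbQ E (N y)) ≤ (⨆ i, succProbQ E (M i)) + ε / 2 * succProb E) :
    IsSimulable ε N M := by
  have : Nonempty (Fin m) := ⟨⟨0, hm⟩⟩
  choose N' hN' hle using fun y => exists_simulated_le hk hε M (N y) fun E =>
    (le_ciSup (f := fun y => succProbQ E (N y)) (Set.finite_range _).bddAbove y).trans (h E)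
  refine ⟨N', hN', csSup_le ⟨_, _, isState_smul_one, rfl⟩ ?_⟩
  rintro _ ⟨X, hX, rfl⟩
  obtain ⟨σ, W, -, hσ1, hW, hT⟩ := exists_traceNorm_tensorId_channel_sub N N' hX
  rw [hT]
  -- The separate choices for each `y` combine because the weights `Tr (σ y)` sum to `1`.
  have := Finset.sum_le_sum fun y (_ : y ∈ Finset.univ) => hle y (σ y) (W y) (hW y)
  rw [← Finset.mul_sum, hσ1] at this
  linarith

end Sufficiency

end MeasSim

theorem mainTheorem10 {C : Type*} [Fintype C] [DecidableEq C] [Nonempty C] {k l m n : ℕ}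
    (hk : 0 < k) (hm : 0 < m)
    (M : Fin k → MeasSim.Measurement C l) (N : Fin m → MeasSim.Measurement C n)
    (ε : ℝ) (hε : 0 ≤ ε) :
    MeasSim.IsSimulable ε N M ↔
      ∀ (r : ℕ) (E : MeasSim.Ensemble C r),
        (⨆ y, MeasSim.succProbQ E (N y)) ≤
          (⨆ i, MeasSim.succProbQ E (M i)) + ε / 2 * MeasSim.succProb E :=
  ⟨fun h _ E => MeasSim.iSup_succProbQ_le_of_isSimulable hm h E,
    -- Ensembles of `n` states suffice: the test families are indexed by the outcomes of `N`.
    fun h => MeasSim.isSimulable_of_forall_iSup_succProbQ_le hk hm hε M N (h n)⟩
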